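/- Let $\gamma>0$. Let $C_p^0(\mathbb{R})$ be the class of functions $f:\mathbb{R}\to\mathbb{C}$ that are piecewise continuous (finitely many discontinuities in each bounded interval) and integrable on every bounded interval. For $l\ge 1$, let $C_p^l(\mathbb{R})$ be the class of functions that are differentiable on $\mathbb{R}$ with derivative in $C_p^{l-1}(\mathbb{R})$, and let $C_{p,\gamma}^l(\mathbb{R})$ be the class of $\gamma$-periodic functions in $C_p^l(\mathbb{R})$. For $k\in\mathbb{C}$ put $[k]_\gamma=\{k+\tfrac{2m\pi}{\gamma} : m\in\mathbb{Z}\}$. **Theorem.** Let $W,V\in C_{p,\gamma}^0(\mathbb{R})$ (complex valued) and $\lambda\in\mathbb{R}$. Every solution $\psi\in C_p^2(\mathbb{R})$ of $$-\psi''+W\psi'+V\psi=\lambda\psi \quad\text{on } \mathbb{R}$$ is of (at least) one of the following forms: 1. $\psi(x)=e^{\mathrm{i}k_0x}p(x)$ with $k_0\in\mathbb{C}$ and $p\in C_{p,\gamma}^2(\mathbb{R})$; 2. $\psi(x)=e^{\mathrm{i}k_0x}\bigl(p_1(x)+x\,p_2(x)\bigr)$ with $k_0\in\mathbb{C}$,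 $p_1,p_2\in C_{p,\gamma}^2(\mathbb{R})$ and $p_2\not\equiv0$; 3. $\psi(x)=e^{\mathrm{i}k_1x}p_1(x)+e^{\mathrm{i}k_2x}p_2(x)$ with $k_1,k_2\in\mathbb{C}$, $[k_1]_\gamma\ne[k_2]_\gamma$ and $p_1,p_2\in C_{p,\gamma}^2(\mathbb{R})$. This holds for both usual readings of $C_p^2(\mathbb{R})$ (the same reading for $\psi$ and for $p,p_1,p_2$): (a) the first and second derivatives exist at every point, and the equation holds at every point; (b) the function is continuously differentiable, its second derivative exists except at finitely many points of each bounded interval and belongs to $C_p^0(\mathbb{R})$, and the equation holds except at finitely many points of each bounded interval. -/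

import Mathlib

/-- A set of reals which has only finitely many points in every bounded interval. -/
def IsolatedSet (S : Set ℝ) : Prop :=
  ∀ a b : ℝ, (S ∩ Set.Icc a b).Finite

/-- The class `C_p^0(ℝ)`: piecewise continuous (finitely many discontinuities in every bounded
interval; they may be infinite) and integrable on every bounded interval. -/
def IsCpZero (f : ℝ → ℂ) : Prop :=
  IsolatedSet {x | ¬ ContinuousAt f x} ∧ MeasureTheory.LocallyIntegrable f MeasureTheory.volume

/-- The class `C_p^l(ℝ)`, with derivatives that exist at every point: `f ∈ C_p^(l+1)(ℝ)` iff `f` is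
differentiable on `ℝ` and `f' ∈ C_p^l(ℝ)`. -/
def IsCp : ℕ → (ℝ → ℂ) → Prop
  | 0, f => IsCpZero f
  | l + 1, f => Differentiable ℝ f ∧ IsCp l (deriv f)

/-- The class `C_p^l(ℝ)` with derivatives taken piecewise: `f` belongs to the class of order `l + 1`
iff it is continuous on `ℝ`, differentiable off an isolated set of points, and its derivative
belongs to the class of order `l`. For `l ≥ 1`, this says that `f` is of class `C^(l-1)`, and that
its derivative of order `l` exists off an isolated set and is in `C_p^0(ℝ)`. (The value `0` that
`deriv` takes where `f` is not differentiable is irrelevant: membership in `IsCpZero` does not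
depend on the values on an isolated set, and if `deriv f` is continuous, as it is in the classes of
order at least one, then `f` is differentiable everywhere.) -/
def IsCpPiecewise : ℕ → (ℝ → ℂ) → Prop
  | 0, f => IsCpZero f
  | l + 1, f =>
      Continuous f ∧ IsolatedSet {x | ¬ DifferentiableAt ℝ f x} ∧ IsCpPiecewise l (deriv f)

/-- The equation `-ψ'' + W ψ' + V ψ = lam ψ` at the point `x`. -/
def SturmLiouvilleAt (W V : ℝ → ℂ) (lam : ℝ) (ψ : ℝ → ℂ) (x : ℝ) : Prop :=
  -deriv (deriv ψ) x + W x * deriv ψ x + V x * ψ x = (lam : ℂ) * ψ x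

/-- The class `[k]_γ = {k + 2mπ/γ : m ∈ ℤ}`. -/
def quasiClass (γ : ℝ) (k : ℂ) : Set ℂ :=
  {z | ∃ m : ℤ, z = k + 2 * (m : ℂ) * (Real.pi : ℂ) / (γ : ℂ)}

/-- `ψ(x) = e^{i k₀ x} p(x)` with `p` a `γ`-periodic function in the class `C`. -/
def IsBlochForm (C : (ℝ → ℂ) → Prop) (γ : ℝ) (ψ : ℝ → ℂ) : Prop :=
  ∃ (k₀ : ℂ) (p : ℝ → ℂ), C p ∧ Function.Periodic p γ ∧
    ∀ x : ℝ, ψ x = Complex.exp (Complex.I * k₀ * x) * p x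

/-- `ψ(x) = e^{i k₀ x} (p₁(x) + x p₂(x))` with `p₁, p₂` `γ`-periodic functions in the class `C`,
`p₂` not identically zero. -/
def IsGrowthForm (C : (ℝ → ℂ) → Prop) (γ : ℝ) (ψ : ℝ → ℂ) : Prop :=
  ∃ (k₀ : ℂ) (p₁ p₂ : ℝ → ℂ), C p₁ ∧ Function.Periodic p₁ γ ∧ C p₂ ∧ Function.Periodic p₂ γ ∧
    (∃ x : ℝ, p₂ x ≠ 0) ∧
    ∀ x : ℝ, ψ x = Complex.exp (Complex.I * k₀ * x) * (p₁ x + (x : ℂ) * p₂ x)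

/-- `ψ(x) = e^{i k₁ x} p₁(x) + e^{i k₂ x} p₂(x)` with `p₁, p₂` `γ`-periodic functions in the class
`C` and `[k₁]_γ ≠ [k₂]_γ`. -/
def IsTwoBlochForm (C : (ℝ → ℂ) → Prop) (γ : ℝ) (ψ : ℝ → ℂ) : Prop :=
  ∃ (k₁ k₂ : ℂ) (p₁ p₂ : ℝ → ℂ), quasiClass γ k₁ ≠ quasiClass γ k₂ ∧
    C p₁ ∧ Function.Periodic p₁ γ ∧ C p₂ ∧ Function.Periodic p₂ γ ∧
    ∀ x : ℝ, ψ x = Complex.exp (Complex.I * k₁ * x) * p₁ x + Complex.exp (Complex.I * k₂ * x) * p₂ x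

open MeasureTheory Set Filter Topology

/-! A solution is determined by its value and derivative at 0 (`IsSolutionOff.eq_zero`), so the
solution space has dimension at most two, and translation by the period, T, maps it to itself. If Tψ
is not a multiple of ψ, then T²ψ = aTψ + bψ. Distinct roots of z² - az - b split ψ into two
eigenfunctions of T; a double root ρ makes (T - ρ)ψ an eigenfunction. Writing an eigenvalue as
e^{ikγ} and dividing by e^{ikx} yields the periodic factors. Existence of solutions is never needed,
because ψ and its translates suffice (`floquet_trichotomy`). The two readings differ only in where
an identity may fail: nowhere, or on an isolated set. Both families are translation invariant ideals
N, and the argument is run once for such an N (`bloch_classification`). -/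

/-! ### Isolated sets and the class `C_p^0` -/

theorem IsolatedSet.mono {S T : Set ℝ} (hT : IsolatedSet T) (h : S ⊆ T) : IsolatedSet S :=
  fun a b => (hT a b).subset (inter_subset_inter_left _ h)

theorem IsolatedSet.union {S T : Set ℝ} (hS : IsolatedSet S) (hT : IsolatedSet T) :
    IsolatedSet (S ∪ T) := fun a b => by
  rw [union_inter_distrib_right]
  exact (hS a b).union (hT a b)

theorem isolatedSet_empty : IsolatedSet ∅ := fun a b => by simp

theorem IsolatedSet.preimage_add_const {S : Set ℝ} (hS : IsolatedSet S) (γ : ℝ) :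
    IsolatedSet ((· + γ) ⁻¹' S) := fun a b => by
  refine ((hS (a + γ) (b + γ)).preimage (add_left_injective γ).injOn).subset ?_
  rintro x ⟨hx, hxa, hxb⟩
  exact ⟨hx, by simpa using hxa, by simpa using hxb⟩

theorem IsolatedSet.countable {S : Set ℝ} (hS : IsolatedSet S) : S.Countable := by
  have : S ⊆ ⋃ n : ℕ, S ∩ Icc (-(n : ℝ)) n := fun x hx => by
    obtain ⟨n, hn⟩ := exists_nat_ge |x|
    exact mem_iUnion.2 ⟨n, hx, abs_le.1 hn⟩
  exact (countable_iUnion fun n : ℕ => (hS _ _).countable).mono this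

theorem IsolatedSet.compl_mem_nhds {S : Set ℝ} (hS : IsolatedSet S) {x : ℝ} (hx : x ∉ S) :
    Sᶜ ∈ 𝓝 x := by
  have h1 : (S ∩ Icc (x - 1) (x + 1))ᶜ ∈ 𝓝 x :=
    (hS _ _).isClosed.isOpen_compl.mem_nhds fun h => hx h.1
  have h2 : Icc (x - 1) (x + 1) ∈ 𝓝 x := Icc_mem_nhds (by linarith) (by linarith)
  filter_upwards [h1, h2] with y hy1 hy2 hy
  exact hy1 ⟨hy, hy2⟩

/-- An isolated set is closed and null, so changing values on it affects neither continuity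
elsewhere nor integrability. This neutralises the default values of `deriv`. -/
theorem IsCpZero.congr {f g : ℝ → ℂ} (hf : IsCpZero f) (h : IsolatedSet {x | f x ≠ g x}) :
    IsCpZero g := by
  refine ⟨(hf.1.union h).mono fun x hx => ?_, hf.2.congr ?_⟩
  · by_contra hc
    simp only [mem_union, not_or] at hc
    refine hx ((not_not.1 hc.1).congr ?_)
    filter_upwards [h.compl_mem_nhds hc.2] with y hy using not_not.1 hy
  · exact h.countable.ae_notMem volume |>.mono fun x hx => not_not.1 hx

theorem Continuous.isCpZero {f : ℝ → ℂ} (hf : Continuous f) : IsCpZero f :=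
  ⟨isolatedSet_empty.mono fun _ hx => hx hf.continuousAt, hf.locallyIntegrable⟩

theorem IsCpZero.add {f g : ℝ → ℂ} (hf : IsCpZero f) (hg : IsCpZero g) :
    IsCpZero (fun x => f x + g x) := by
  refine ⟨(hf.1.union hg.1).mono fun x hx => ?_, hf.2.add hg.2⟩
  by_contra hc
  simp only [mem_union, not_or, mem_ofPred_eq, not_not] at hc
  exact hx (hc.1.add hc.2)

theorem IsCpZero.continuous_mul {f g : ℝ → ℂ} (hg : Continuous g) (hf : IsCpZero f) :
    IsCpZero (fun x => g x * f x) :=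
  ⟨hf.1.mono fun _ hx hc => hx (hg.continuousAt.mul hc), hf.2.continuous_mul hg⟩

theorem IsCpZero.comp_add_const {f : ℝ → ℂ} (hf : IsCpZero f) (γ : ℝ) :
    IsCpZero (fun x => f (x + γ)) := by
  refine ⟨(hf.1.preimage_add_const γ).mono fun x hx hc => hx ?_, ?_⟩
  · exact ContinuousAt.comp (f := fun y : ℝ => y + γ) hc (by fun_prop)
  · have := (locallyIntegrable_map_homeomorph (Homeomorph.addRight γ) (f := f) (μ := volume)).1
    rw [show Measure.map (Homeomorph.addRight γ) (volume : Measure ℝ) = volume from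
      map_add_right_eq_self volume γ] at this
    exact this hf.2

/-! ### Uniqueness with locally integrable coefficients -/

theorem MeasureTheory.LocallyIntegrable.norm_real {E : Type*} [NormedAddCommGroup E] {f : ℝ → E}
    (hf : LocallyIntegrable f) : LocallyIntegrable fun x => ‖f x‖ :=
  locallyIntegrableOn_univ.1 (hf.locallyIntegrableOn univ).norm

theorem MeasureTheory.LocallyIntegrable.intervalIntegrable_real {E : Type*} [NormedAddCommGroup E] {f : ℝ → E}
    (hf : LocallyIntegrable f) (a b : ℝ) : IntervalIntegrable f volume a b :=
  (hf.integrableOn_isCompact isCompact_uIcc).intervalIntegrable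

/-- Uniqueness for linear differential inequalities with a locally integrable coefficient. -/
theorem eq_zero_of_norm_deriv_le {E : Type*} [NormedAddCommGroup E] [NormedSpace ℝ E]
    [CompleteSpace E] {w w' : ℝ → E} {k : ℝ → ℝ} {s : Set ℝ} (hs : s.Countable)
    (hk : LocallyIntegrable k) (hk0 : ∀ x, 0 ≤ k x) (hw : Continuous w)
    (hw' : LocallyIntegrable w') (hderiv : ∀ x ∉ s, HasDerivAt w (w' x) x)
    (hle : ∀ x ∉ s, ‖w' x‖ ≤ k x * ‖w x‖) {a : ℝ} (ha : w a = 0) (x : ℝ) : w x = 0 := by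
  -- The zero set is closed, so openness suffices. Near a zero, on a ball where the integral of `k`
  -- from the centre is below 1/2 in absolute value, the maximum M of ‖w‖ satisfies M ≤ M/2.
  have hopen : IsOpen {x | w x = 0} := by
    rw [isOpen_iff_mem_nhds]
    intro x₀ hx₀
    have hF : Continuous fun b => ∫ t in x₀..b, k t :=
      intervalIntegral.continuous_primitive hk.intervalIntegrable_real x₀
    have hFs : ∀ᶠ b in 𝓝 x₀, |∫ t in x₀..b, k t| < 1 / 2 :=
      hF.abs.continuousAt.eventually_lt continuousAt_const (by simp)
    obtain ⟨r, hr, hball⟩ := Metric.nhds_basis_closedBall.eventually_iff.1 hFs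
    obtain ⟨y, hy, hmax⟩ := (isCompact_closedBall x₀ r).exists_isMaxOn
      ⟨x₀, Metric.mem_closedBall_self hr.le⟩ hw.norm.continuousOn
    have hsub : uIoc x₀ y ⊆ Metric.closedBall x₀ r := by
      rw [Real.closedBall_eq_Icc] at hy ⊢
      exact uIoc_subset_uIcc.trans (uIcc_subset_Icc ⟨by linarith, by linarith⟩ hy)
    have hint : ∫ t in x₀..y, w' t = w y := by
      rw [integral_eq_of_hasDerivAt_off_countable w w' hs hw.continuousOn
        (fun t ht => hderiv t ht.2) (hw'.intervalIntegrable_real _ _), hx₀, sub_zero]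
    have hbound : ‖w y‖ ≤ |∫ t in x₀..y, k t * ‖w y‖| := by
      nth_rewrite 1 [← hint]
      refine intervalIntegral.norm_integral_le_abs_of_norm_le ?_
        ((hk.intervalIntegrable_real _ _).mul_const _)
      filter_upwards [ae_restrict_mem measurableSet_uIoc,
        ae_restrict_of_ae (hs.ae_notMem volume)] with t ht hts
      exact (hle t hts).trans (mul_le_mul_of_nonneg_left (hmax (hsub ht)) (hk0 t))
    rw [intervalIntegral.integral_mul_const, abs_mul, abs_norm] at hbound
    have hy0 : ‖w y‖ = 0 := by
      have := hball hy
      nlinarith [norm_nonneg (w y)]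
    filter_upwards [Metric.closedBall_mem_nhds x₀ hr] with z hz
    exact norm_le_zero_iff.1 ((hmax hz).trans_eq hy0)
  have huniv := IsClopen.eq_univ ⟨isClosed_eq hw continuous_const, hopen⟩ ⟨a, ha⟩
  exact huniv.ge (mem_univ x)

/-! ### Solutions off exceptional sets -/

/-- A translation invariant ideal of isolated subsets of the line. -/
structure IsExceptionalIdeal (N : Set ℝ → Prop) : Prop where
  mono : ∀ {S T}, N T → S ⊆ T → N S
  union : ∀ {S T}, N S → N T → N (S ∪ T)
  translate : ∀ {S}, N S → ∀ γ : ℝ, N ((· + γ) ⁻¹' S)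
  isolated : ∀ {S}, N S → IsolatedSet S

theorem isExceptionalIdeal_isolatedSet : IsExceptionalIdeal IsolatedSet :=
  ⟨fun h => h.mono, fun h => h.union, fun h => h.preimage_add_const, id⟩

theorem isExceptionalIdeal_eq_empty : IsExceptionalIdeal (· = ∅) where
  mono := fun h hS => subset_eq_empty hS h
  union := fun h h' => by simp [h, h']
  translate := fun h γ => by simp [h]
  isolated := fun h => h ▸ isolatedSet_empty

/-- `u` is the derivative of `f`, is continuous, and has derivative `v`, in `C_p^0(ℝ)`, off an
exceptional set. -/
structure HasSecondDerivOff (N : Set ℝ → Prop) (f u v : ℝ → ℂ) : Prop where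
  hasDerivAt : ∀ x, HasDerivAt f (u x) x
  continuous : Continuous u
  second : N {x | ¬ HasDerivAt u (v x) x}
  isCpZero : IsCpZero v

section

variable {N : Set ℝ → Prop} {f g u v u' v' : ℝ → ℂ}

theorem HasSecondDerivOff.continuous_self (h : HasSecondDerivOff N f u v) : Continuous f :=
  continuous_iff_continuousAt.2 fun x => (h.hasDerivAt x).continuousAt

theorem HasSecondDerivOff.add (hN : IsExceptionalIdeal N) (h : HasSecondDerivOff N f u v)
    (h' : HasSecondDerivOff N g u' v') :
    HasSecondDerivOff N (fun x => f x + g x) (fun x => u x + u' x) (fun x => v x + v' x) where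
  hasDerivAt x := (h.hasDerivAt x).add (h'.hasDerivAt x)
  continuous := h.continuous.add h'.continuous
  second := hN.mono (hN.union h.second h'.second) fun x hx => by
    by_contra hc
    simp only [mem_union, not_or, mem_ofPred_eq, not_not] at hc
    exact hx (hc.1.add hc.2)
  isCpZero := h.isCpZero.add h'.isCpZero

/-- One product rule serves all the multipliers needed: constants, exponentials and -x. -/
theorem HasSecondDerivOff.smooth_mul (hN : IsExceptionalIdeal N) (h : HasSecondDerivOff N f u v)
    {a b c : ℝ → ℂ} (ha : ∀ x, HasDerivAt a (b x) x) (hb : ∀ x, HasDerivAt b (c x) x)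
    (hc : Continuous c) :
    HasSecondDerivOff N (fun x => a x * f x) (fun x => b x * f x + a x * u x)
      (fun x => (c x * f x + b x * u x) + (b x * u x + a x * v x)) := by
  have ha' : Continuous a := continuous_iff_continuousAt.2 fun x => (ha x).continuousAt
  have hb' : Continuous b := continuous_iff_continuousAt.2 fun x => (hb x).continuousAt
  have hf := h.continuous_self
  have hu := h.continuous
  refine ⟨fun x => (ha x).mul (h.hasDerivAt x), by fun_prop,
    hN.mono h.second fun x hx hd => hx ?_, ?_⟩
  · exact ((hb x).mul (h.hasDerivAt x)).add ((ha x).mul hd)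
  · exact (Continuous.isCpZero (by fun_prop)).add
      ((Continuous.isCpZero (by fun_prop)).add (h.isCpZero.continuous_mul ha'))

theorem HasSecondDerivOff.const_mul (hN : IsExceptionalIdeal N) (h : HasSecondDerivOff N f u v)
    (c : ℂ) : HasSecondDerivOff N (fun x => c * f x) (fun x => c * u x) (fun x => c * v x) := by
  have := h.smooth_mul hN (a := fun _ => c) (b := 0) (c := 0) (fun x => hasDerivAt_const x c)
    (fun x => hasDerivAt_const x 0) continuous_const
  simpa using this

theorem HasSecondDerivOff.comp_add_const (hN : IsExceptionalIdeal N)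
    (h : HasSecondDerivOff N f u v) (γ : ℝ) :
    HasSecondDerivOff N (fun x => f (x + γ)) (fun x => u (x + γ)) (fun x => v (x + γ)) where
  hasDerivAt x := (h.hasDerivAt (x + γ)).comp_add_const x γ
  continuous := h.continuous.comp (continuous_add_const γ)
  second := hN.mono (hN.translate h.second γ) fun x hx hd => hx (hd.comp_add_const x γ)
  isCpZero := h.isCpZero.comp_add_const γ

/-- `f` is a solution of `-f'' + W f' + V f = lam f` off an exceptional set. -/
def IsSolutionOff (N : Set ℝ → Prop) (W V : ℝ → ℂ) (lam : ℝ) (f : ℝ → ℂ) : Prop :=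
  ∃ u v, HasSecondDerivOff N f u v ∧
    N {x | ¬ (-v x + W x * u x + V x * f x = (lam : ℂ) * f x)}

/-- Membership in the class of order two whose second derivatives exist off an exceptional set. -/
def HasSecondDeriv (N : Set ℝ → Prop) (f : ℝ → ℂ) : Prop := ∃ u v, HasSecondDerivOff N f u v

variable {W V : ℝ → ℂ} {lam : ℝ}

theorem IsSolutionOff.hasSecondDeriv (h : IsSolutionOff N W V lam f) : HasSecondDeriv N f := by
  obtain ⟨u, v, h, -⟩ := h
  exact ⟨u, v, h⟩

theorem IsSolutionOff.add (hN : IsExceptionalIdeal N) (h : IsSolutionOff N W V lam f)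
    (h' : IsSolutionOff N W V lam g) : IsSolutionOff N W V lam (fun x => f x + g x) := by
  obtain ⟨u, v, h, e⟩ := h
  obtain ⟨u', v', h', e'⟩ := h'
  refine ⟨_, _, h.add hN h', hN.mono (hN.union e e') fun x hx => ?_⟩
  by_contra hc
  simp only [mem_union, not_or, mem_ofPred_eq, not_not] at hc
  exact hx (by linear_combination hc.1 + hc.2)

theorem IsSolutionOff.const_mul (hN : IsExceptionalIdeal N) (h : IsSolutionOff N W V lam f)
    (c : ℂ) : IsSolutionOff N W V lam (fun x => c * f x) := by
  obtain ⟨u, v, h, e⟩ := h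
  exact ⟨_, _, h.const_mul hN c, hN.mono e fun x hx hd => hx (by linear_combination c * hd)⟩

theorem IsSolutionOff.comp_add_const (hN : IsExceptionalIdeal N) {γ : ℝ}
    (hW : Function.Periodic W γ) (hV : Function.Periodic V γ) (h : IsSolutionOff N W V lam f) :
    IsSolutionOff N W V lam (fun x => f (x + γ)) := by
  obtain ⟨u, v, h, e⟩ := h
  refine ⟨_, _, h.comp_add_const hN γ, hN.mono (hN.translate e γ) fun x hx hd => hx ?_⟩
  simpa only [hW x, hV x] using hd

theorem IsSolutionOff.eq_zero (hN : IsExceptionalIdeal N) (hW : IsCpZero W) (hV : IsCpZero V)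
    (h : IsSolutionOff N W V lam f) (h0 : f 0 = 0) (h1 : deriv f 0 = 0) (x : ℝ) : f x = 0 := by
  obtain ⟨u, v, h, e⟩ := h
  rw [(h.hasDerivAt 0).deriv] at h1
  have hs := hN.isolated (hN.union h.second e)
  -- This coefficient bounds the first-order system (f, u)' = (u, Wu + (V - lam)f) in the maximum
  -- norm.
  have hk : LocallyIntegrable fun x => 1 + ‖W x‖ + ‖V x - lam‖ :=
    ((locallyIntegrable_const (1 : ℝ)).add hW.2.norm_real).add
      (hV.2.sub (locallyIntegrable_const (lam : ℂ))).norm_real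
  have hw' : LocallyIntegrable fun x => (u x, v x) := fun x => by
    obtain ⟨s, hs, hus⟩ := h.continuous.locallyIntegrable (μ := volume) x
    obtain ⟨t, ht, hvt⟩ := h.isCpZero.2 x
    exact ⟨s ∩ t, inter_mem hs ht, (hus.mono_set inter_subset_left).prodMk
      (hvt.mono_set inter_subset_right)⟩
  have key := eq_zero_of_norm_deriv_le (w := fun x => (f x, u x)) (w' := fun x => (u x, v x))
    hs.countable hk (fun x => by positivity) (h.continuous_self.prodMk h.continuous) hw'
    (fun x hx => ?_) (fun x hx => ?_) (a := 0) (by simp [h0, h1]) x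
  · exact congrArg Prod.fst key
  · simp only [mem_union, not_or, mem_ofPred_eq, not_not] at hx
    exact (h.hasDerivAt x).prodMk hx.1
  · simp only [mem_union, not_or, mem_ofPred_eq, not_not] at hx
    have hv : v x = W x * u x + (V x - lam) * f x := by linear_combination -hx.2
    have hf' : ‖f x‖ ≤ ‖(f x, u x)‖ := norm_fst_le (f x, u x)
    have hu' : ‖u x‖ ≤ ‖(f x, u x)‖ := norm_snd_le (f x, u x)
    rw [Prod.norm_mk (u x), max_le_iff]
    have hA := norm_nonneg (W x)
    have hB := norm_nonneg (V x - lam)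
    have hC := norm_nonneg (f x, u x)
    constructor
    · nlinarith [mul_nonneg hA hC, mul_nonneg hB hC]
    · have := norm_add_le (W x * u x) ((V x - lam) * f x)
      rw [← hv, norm_mul, norm_mul] at this
      nlinarith [mul_le_mul_of_nonneg_left hu' hA, mul_le_mul_of_nonneg_left hf' hB]

end

/-! ### Floquet's trichotomy -/

/-- Floquet's decomposition of an element of a translation invariant space of functions that are
determined by their value and derivative at the origin. -/
theorem floquet_trichotomy {S : (ℝ → ℂ) → Prop} (γ : ℝ)
    (hadd : ∀ f g, S f → S g → S (fun x => f x + g x))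
    (hmul : ∀ f, S f → ∀ c : ℂ, S (fun x => c * f x))
    (htrans : ∀ f, S f → S (fun x => f (x + γ)))
    (hdiff : ∀ f, S f → Differentiable ℝ f)
    (huniq : ∀ f, S f → f 0 = 0 → deriv f 0 = 0 → ∀ x, f x = 0) {ψ : ℝ → ℂ} (hψ : S ψ) :
    (∃ ρ : ℂ, ρ ≠ 0 ∧ ∀ x, ψ (x + γ) = ρ * ψ x) ∨
    (∃ (ρ : ℂ) (φ : ℝ → ℂ), ρ ≠ 0 ∧ S φ ∧ (∃ x, φ x ≠ 0) ∧ (∀ x, φ (x + γ) = ρ * φ x) ∧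
      ∀ x, ψ (x + γ) = ρ * ψ x + φ x) ∨
    (∃ (ρ₁ ρ₂ : ℂ) (φ₁ φ₂ : ℝ → ℂ), ρ₁ ≠ 0 ∧ ρ₂ ≠ 0 ∧ ρ₁ ≠ ρ₂ ∧ S φ₁ ∧ S φ₂ ∧
      (∀ x, φ₁ (x + γ) = ρ₁ * φ₁ x) ∧ (∀ x, φ₂ (x + γ) = ρ₂ * φ₂ x) ∧
      ∀ x, ψ x = φ₁ x + φ₂ x) := by
  have hS1 := htrans _ hψ
  have hS2 := htrans _ hS1
  have hcomb : ∀ a b : ℂ, S fun x => a * ψ (x + γ) + b * ψ x := fun a b =>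
    hadd _ _ (hmul _ hS1 a) (hmul _ hψ b)
  have hlin : ∀ a b : ℂ, a * ψ (0 + γ) + b * ψ 0 = 0 →
      a * deriv (fun x => ψ (x + γ)) 0 + b * deriv ψ 0 = 0 →
      ∀ x, a * ψ (x + γ) + b * ψ x = 0 := fun a b h0 h1 => by
    refine huniq _ (hcomb a b) h0 ?_
    rw [← h1]
    exact (((hdiff _ hS1 0).hasDerivAt.const_mul a).add
      ((hdiff _ hψ 0).hasDerivAt.const_mul b)).deriv
  by_cases hz : ∀ x, ψ x = 0
  · exact Or.inl ⟨1, one_ne_zero, fun x => by simp [hz]⟩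
  by_cases hex : ∃ ρ : ℂ, ∀ x, ψ (x + γ) = ρ * ψ x
  · obtain ⟨ρ, hρ⟩ := hex
    -- A zero multiplier would make the translate, hence ψ itself, vanish.
    refine Or.inl ⟨ρ, fun h => hz fun x => ?_, hρ⟩
    simpa [h] using hρ (x - γ)
  refine Or.inr ?_
  -- `ψ` and its translate are linearly independent.
  have hind : ∀ b : ℂ, ¬ ∀ x, ψ (x + γ) = b * ψ x := fun b hb => hex ⟨b, hb⟩
  -- The Wronskian at 0 of the translate and ψ, up to sign convention. If it vanished, the initial
  -- data would be proportional, and by uniqueness so would the functions.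
  set D : ℂ := ψ (0 + γ) * deriv ψ 0 - ψ 0 * deriv (fun x => ψ (x + γ)) 0 with hD
  have hD0 : D ≠ 0 := by
    intro h
    by_cases h0 : ψ 0 = 0
    · by_cases h1 : deriv ψ 0 = 0
      · exact hz (huniq _ hψ h0 h1)
      · refine hind (deriv (fun x => ψ (x + γ)) 0 / deriv ψ 0) fun x => ?_
        have := hlin (deriv ψ 0) (-deriv (fun x => ψ (x + γ)) 0)
          (by linear_combination h) (by ring) x
        field_simp
        linear_combination this
    · refine hind (ψ (0 + γ) / ψ 0) fun x => ?_
      have := hlin (ψ 0) (-ψ (0 + γ)) (by ring) (by linear_combination -h) x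
      field_simp
      linear_combination this
  obtain ⟨a, b, hab⟩ : ∃ a b : ℂ, ∀ x, ψ (x + γ + γ) = a * ψ (x + γ) + b * ψ x := by
    set p := ψ (0 + γ + γ) with hp
    set q := deriv (fun x => ψ (x + γ + γ)) 0 with hq
    -- Cramer's rule: `a` and `b` match the value and derivative of T²ψ at 0.
    set a := (p * deriv ψ 0 - ψ 0 * q) / D with ha
    set b := (ψ (0 + γ) * q - p * deriv (fun x => ψ (x + γ)) 0) / D with hb
    have hsol := hadd _ _ hS2 (hcomb (-a) (-b))
    have haD : a * D = p * deriv ψ 0 - ψ 0 * q := div_mul_cancel₀ _ hD0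
    have hbD : b * D = ψ (0 + γ) * q - p * deriv (fun x => ψ (x + γ)) 0 := div_mul_cancel₀ _ hD0
    refine ⟨a, b, fun x => ?_⟩
    have hzero := huniq _ hsol ?_ ?_ x
    · linear_combination hzero
    · refine (mul_eq_zero_iff_left hD0).1 ?_
      linear_combination -ψ (0 + γ) * haD - ψ 0 * hbD + p * hD
    · refine ((hdiff _ hS2 0).hasDerivAt.add (((hdiff _ hS1 0).hasDerivAt.const_mul (-a)).add
        ((hdiff _ hψ 0).hasDerivAt.const_mul (-b)))).deriv.trans ?_
      refine (mul_eq_zero_iff_left hD0).1 ?_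
      linear_combination -deriv (fun x => ψ (x + γ)) 0 * haD - deriv ψ 0 * hbD + q * hD
  -- With b = 0, translating T²ψ = aTψ back by one period would give Tψ = aψ.
  have hb0 : b ≠ 0 := fun h => hind a fun x => by
    simpa [h] using hab (x - γ)
  obtain ⟨s, hs⟩ := IsAlgClosed.exists_pow_nat_eq (a ^ 2 + 4 * b) (n := 2) two_pos
  obtain ⟨ρ₁, ρ₂, hsum, hprod⟩ : ∃ ρ₁ ρ₂ : ℂ, ρ₁ + ρ₂ = a ∧ ρ₁ * ρ₂ = -b :=
    ⟨(a + s) / 2, (a - s) / 2, by ring, by linear_combination -hs / 4⟩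
  have h1 : ρ₁ ≠ 0 := fun h => hb0 (by simpa [h] using hprod.symm)
  have h2 : ρ₂ ≠ 0 := fun h => hb0 (by simpa [h] using hprod.symm)
  by_cases heq : ρ₁ = ρ₂
  · subst heq
    refine Or.inl ⟨ρ₁, fun x => 1 * ψ (x + γ) + -ρ₁ * ψ x, h1, hcomb _ _, ?_, fun x => ?_,
      fun x => by ring⟩
    · by_contra! hc
      exact hind ρ₁ fun x => by linear_combination hc x
    · linear_combination hab x - ψ (x + γ) * hsum + ψ x * hprod
  · have hne : ρ₁ - ρ₂ ≠ 0 := sub_ne_zero.2 heq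
    -- The spectral components (T - ρ₂)ψ/(ρ₁ - ρ₂) and (T - ρ₁)ψ/(ρ₂ - ρ₁).
    refine Or.inr ⟨ρ₁, ρ₂, fun x => (ρ₁ - ρ₂)⁻¹ * ψ (x + γ) + -(ρ₁ - ρ₂)⁻¹ * ρ₂ * ψ x,
      fun x => -(ρ₁ - ρ₂)⁻¹ * ψ (x + γ) + (ρ₁ - ρ₂)⁻¹ * ρ₁ * ψ x, h1, h2, heq,
      hcomb _ _, hcomb _ _, fun x => ?_, fun x => ?_, fun x => ?_⟩
    · linear_combination (ρ₁ - ρ₂)⁻¹ * (hab x - ψ (x + γ) * hsum + ψ x * hprod)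
    · linear_combination -(ρ₁ - ρ₂)⁻¹ * (hab x - ψ (x + γ) * hsum + ψ x * hprod)
    · field_simp
      ring

/-! ### From multipliers to Bloch forms -/

theorem exists_exp_mul_eq {γ : ℝ} (hγ : 0 < γ) {ρ : ℂ} (hρ : ρ ≠ 0) :
    ∃ k : ℂ, Complex.exp (Complex.I * k * γ) = ρ := by
  have hγ' : (γ : ℂ) ≠ 0 := by exact_mod_cast hγ.ne'
  refine ⟨-Complex.I * Complex.log ρ / γ, ?_⟩
  rw [show Complex.I * (-Complex.I * Complex.log ρ / γ) * γ = Complex.log ρ by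
    field_simp
    simp, Complex.exp_log hρ]

theorem exp_eq_of_quasiClass_eq {γ : ℝ} (hγ : 0 < γ) {k₁ k₂ : ℂ}
    (h : quasiClass γ k₁ = quasiClass γ k₂) :
    Complex.exp (Complex.I * k₁ * γ) = Complex.exp (Complex.I * k₂ * γ) := by
  have hγ' : (γ : ℂ) ≠ 0 := by exact_mod_cast hγ.ne'
  have hk : k₁ ∈ quasiClass γ k₂ := h ▸ ⟨0, by simp⟩
  obtain ⟨m, hm⟩ := hk
  refine Complex.exp_eq_exp_iff_exists_int.2 ⟨m, ?_⟩
  rw [hm]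
  field_simp

theorem periodic_exp_mul {γ : ℝ} {k : ℂ} {f : ℝ → ℂ}
    (hf : ∀ x, f (x + γ) = Complex.exp (Complex.I * k * γ) * f x) :
    Function.Periodic (fun x : ℝ => Complex.exp (-(Complex.I * k) * x) * f x) γ := fun x => by
  simp only [hf, ← mul_assoc, ← Complex.exp_add]
  congr 2
  push_cast
  ring

theorem exp_mul_exp_neg_mul (k : ℂ) (x : ℝ) (z : ℂ) :
    Complex.exp (Complex.I * k * x) * (Complex.exp (-(Complex.I * k) * x) * z) = z := by
  rw [← mul_assoc, ← Complex.exp_add, neg_mul, add_neg_cancel, Complex.exp_zero, one_mul]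

theorem HasSecondDeriv.exp_mul {N : Set ℝ → Prop} (hN : IsExceptionalIdeal N) {f : ℝ → ℂ}
    (h : HasSecondDeriv N f) (c : ℂ) : HasSecondDeriv N fun x => Complex.exp (c * x) * f x := by
  obtain ⟨u, v, h⟩ := h
  have hexp : ∀ x : ℝ, HasDerivAt (fun x : ℝ => Complex.exp (c * x))
      (c * Complex.exp (c * x)) x := fun x => by
    have := (((hasDerivAt_id (x : ℂ)).const_mul c).cexp).comp_ofReal
    simpa [mul_comm] using this
  exact ⟨_, _, h.smooth_mul hN hexp (fun x => (hexp x).const_mul c) (by fun_prop)⟩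

theorem bloch_classification {N : Set ℝ → Prop} (hN : IsExceptionalIdeal N) {γ : ℝ} (hγ : 0 < γ)
    {W V : ℝ → ℂ} (hW : IsCpZero W) (hWper : Function.Periodic W γ)
    (hV : IsCpZero V) (hVper : Function.Periodic V γ) {lam : ℝ} {ψ : ℝ → ℂ}
    (hψ : IsSolutionOff N W V lam ψ) :
    IsBlochForm (HasSecondDeriv N) γ ψ ∨ IsGrowthForm (HasSecondDeriv N) γ ψ ∨
      IsTwoBlochForm (HasSecondDeriv N) γ ψ := by
  have hγ' : (γ : ℂ) ≠ 0 := by exact_mod_cast hγ.ne'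
  rcases floquet_trichotomy (S := IsSolutionOff N W V lam) γ
    (fun f g hf hg => hf.add hN hg) (fun f hf c => hf.const_mul hN c)
    (fun f hf => hf.comp_add_const hN hWper hVper)
    (fun f ⟨_, _, h, _⟩ x => (h.hasDerivAt x).differentiableAt)
    (fun f hf => hf.eq_zero hN hW hV) hψ with ⟨ρ, hρ, h⟩ | ⟨ρ, φ, hρ, hφ, ⟨y, hy⟩, hφρ, h⟩ |
      ⟨ρ₁, ρ₂, φ₁, φ₂, hρ₁, hρ₂, hne, hφ₁, hφ₂, h₁, h₂, h⟩
  · obtain ⟨k, rfl⟩ := exists_exp_mul_eq hγ hρ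
    exact Or.inl ⟨k, _, hψ.hasSecondDeriv.exp_mul hN _, periodic_exp_mul h,
      fun x => (exp_mul_exp_neg_mul k x _).symm⟩
  · obtain ⟨k, rfl⟩ := exists_exp_mul_eq hγ hρ
    set ρ := Complex.exp (Complex.I * k * γ) with hρdef
    -- Translation sends xφ/(γρ) to ρ·xφ/(γρ) + φ. Hence ψ - xφ/(γρ) has multiplier ρ, and φ/(γρ)
    -- supplies `p₂`.
    obtain ⟨u, v, hφc⟩ := (hφ.const_mul hN (1 / (γ * ρ))).hasSecondDeriv
    have hper : ∀ x : ℝ, 1 / (γ * ρ) * φ (x + γ) = ρ * (1 / (γ * ρ) * φ x) := fun x => by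
      rw [hφρ]; ring
    have hid : ∀ x : ℝ, HasDerivAt (fun x : ℝ => -(x : ℂ)) (-1) x := fun x =>
      Complex.ofRealCLM.hasDerivAt.neg
    have hxφ := hφc.smooth_mul hN hid (c := 0) (fun x => hasDerivAt_const x (-1)) continuous_const
    obtain ⟨u₁, v₁, hψ₁⟩ := hψ.hasSecondDeriv
    have hp : HasSecondDeriv N (fun x : ℝ => ψ x + -(x : ℂ) * (1 / (γ * ρ) * φ x)) :=
      ⟨_, _, hψ₁.add hN hxφ⟩
    refine Or.inr (Or.inl ⟨k, _, _, hp.exp_mul hN (-(Complex.I * k)), periodic_exp_mul fun x => ?_,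
      HasSecondDeriv.exp_mul hN ⟨u, v, hφc⟩ (-(Complex.I * k)), periodic_exp_mul hper,
      ⟨y, ?_⟩, fun x => ?_⟩)
    · rw [h, hφρ, ← hρdef]
      push_cast
      field_simp
      ring
    · exact mul_ne_zero (Complex.exp_ne_zero _)
        (mul_ne_zero (one_div_ne_zero (mul_ne_zero hγ' hρ)) hy)
    · rw [mul_left_comm (x : ℂ), ← mul_add, exp_mul_exp_neg_mul]
      ring
  · obtain ⟨k₁, rfl⟩ := exists_exp_mul_eq hγ hρ₁
    obtain ⟨k₂, rfl⟩ := exists_exp_mul_eq hγ hρ₂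
    refine Or.inr (Or.inr ⟨k₁, k₂, _, _, fun hc => hne (exp_eq_of_quasiClass_eq hγ hc),
      hφ₁.hasSecondDeriv.exp_mul hN _, periodic_exp_mul h₁,
      hφ₂.hasSecondDeriv.exp_mul hN _, periodic_exp_mul h₂, fun x => ?_⟩)
    rw [exp_mul_exp_neg_mul, exp_mul_exp_neg_mul, h]

/-! ### The two readings of `C_p^2` -/

theorem IsCp.hasSecondDerivOff {f : ℝ → ℂ} (h : IsCp 2 f) :
    HasSecondDerivOff (· = ∅) f (deriv f) (deriv (deriv f)) := by
  obtain ⟨h0, h1, h2⟩ := h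
  refine ⟨fun x => (h0 x).hasDerivAt, h1.continuous, ?_, h2⟩
  exact eq_empty_of_forall_notMem fun x hx => hx (h1 x).hasDerivAt

theorem HasSecondDeriv.isCp {f : ℝ → ℂ} (h : HasSecondDeriv (· = ∅) f) : IsCp 2 f := by
  obtain ⟨u, v, h⟩ := h
  have hu : deriv f = u := funext fun x => (h.hasDerivAt x).deriv
  have hd : ∀ x, HasDerivAt u (v x) x := fun x => by
    by_contra hc
    exact (h.second ▸ hc : x ∈ (∅ : Set ℝ))
  have hv : deriv u = v := funext fun x => (hd x).deriv
  refine ⟨fun x => (h.hasDerivAt x).differentiableAt, ?_, ?_⟩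
  · rw [hu]; exact fun x => (hd x).differentiableAt
  · rw [hu, hv]; exact h.isCpZero

/-- The fundamental theorem of calculus off a countable set makes f a primitive of the continuous
function `deriv f`, so the exceptional points are in fact points of differentiability. -/
theorem hasDerivAt_deriv_of_isolatedSet {f : ℝ → ℂ} (hf : Continuous f)
    (hS : IsolatedSet {x | ¬ DifferentiableAt ℝ f x}) (hf' : Continuous (deriv f)) (x : ℝ) :
    HasDerivAt f (deriv f x) x := by
  have hint : ∀ y, f y = f 0 + ∫ t in (0 : ℝ)..y, deriv f t := fun y => by
    rw [integral_eq_of_hasDerivAt_off_countable f (deriv f) hS.countable hf.continuousOn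
      (fun t ht => (not_not.1 ht.2).hasDerivAt) (hf'.intervalIntegrable _ _), add_sub_cancel]
  rw [funext hint]
  have := (hf'.integral_hasStrictDerivAt 0 x).hasDerivAt.const_add (f 0)
  rwa [← funext hint] at this ⊢

theorem IsCpPiecewise.hasSecondDerivOff {f : ℝ → ℂ} (h : IsCpPiecewise 2 f) :
    HasSecondDerivOff IsolatedSet f (deriv f) (deriv (deriv f)) := by
  obtain ⟨h0, h0', h1, h1', h2⟩ := h
  exact ⟨hasDerivAt_deriv_of_isolatedSet h0 h0' h1, h1,
    h1'.mono fun x hx hd => hx hd.hasDerivAt, h2⟩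

theorem HasSecondDeriv.isCpPiecewise {f : ℝ → ℂ} (h : HasSecondDeriv IsolatedSet f) :
    IsCpPiecewise 2 f := by
  obtain ⟨u, v, h⟩ := h
  have hu : deriv f = u := funext fun x => (h.hasDerivAt x).deriv
  refine ⟨h.continuous_self, isolatedSet_empty.mono fun x hx =>
    hx (h.hasDerivAt x).differentiableAt, ?_⟩
  rw [hu]
  exact ⟨h.continuous, h.second.mono fun x hx hd => hx hd.differentiableAt,
    h.isCpZero.congr (h.second.mono fun x hx hd => hx hd.deriv.symm)⟩

theorem bloch_forms_mono {C C' : (ℝ → ℂ) → Prop} (hC : ∀ f, C f → C' f) {γ : ℝ} {ψ : ℝ → ℂ}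
    (h : IsBlochForm C γ ψ ∨ IsGrowthForm C γ ψ ∨ IsTwoBlochForm C γ ψ) :
    IsBlochForm C' γ ψ ∨ IsGrowthForm C' γ ψ ∨ IsTwoBlochForm C' γ ψ := by
  rcases h with ⟨k, p, hp, h⟩ | ⟨k, p₁, p₂, hp₁, hper₁, hp₂, h⟩ |
    ⟨k₁, k₂, p₁, p₂, hk, hp₁, hper₁, hp₂, h⟩
  · exact Or.inl ⟨k, p, hC _ hp, h⟩
  · exact Or.inr (Or.inl ⟨k, p₁, p₂, hC _ hp₁, hper₁, hC _ hp₂, h⟩)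
  · exact Or.inr (Or.inr ⟨k₁, k₂, p₁, p₂, hk, hC _ hp₁, hper₁, hC _ hp₂, h⟩)

/-- The classification, with `C_p^2(ℝ)` read in either way: derivatives existing at every point and
the equation holding at every point, or derivatives taken piecewise and the equation holding off an
isolated set of points. -/
theorem mainTheorem2 (γ : ℝ) (hγ : 0 < γ) (W V : ℝ → ℂ)
    (hW : IsCpZero W) (hWper : Function.Periodic W γ)
    (hV : IsCpZero V) (hVper : Function.Periodic V γ) (lam : ℝ) :
    (∀ ψ : ℝ → ℂ, IsCp 2 ψ → (∀ x : ℝ, SturmLiouvilleAt W V lam ψ x) →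
      IsBlochForm (IsCp 2) γ ψ ∨ IsGrowthForm (IsCp 2) γ ψ ∨ IsTwoBlochForm (IsCp 2) γ ψ) ∧
    (∀ ψ : ℝ → ℂ, IsCpPiecewise 2 ψ → IsolatedSet {x | ¬ SturmLiouvilleAt W V lam ψ x} →
      IsBlochForm (IsCpPiecewise 2) γ ψ ∨ IsGrowthForm (IsCpPiecewise 2) γ ψ ∨
        IsTwoBlochForm (IsCpPiecewise 2) γ ψ) := by

  refine ⟨fun ψ hψ heq => ?_, fun ψ hψ heq => ?_⟩
  · exact bloch_forms_mono (fun f hf => hf.isCp)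
      (bloch_classification isExceptionalIdeal_eq_empty hγ hW hWper hV hVper
        ⟨_, _, hψ.hasSecondDerivOff, eq_empty_of_forall_notMem fun x hx => hx (heq x)⟩)
  · exact bloch_forms_mono (fun f hf => hf.isCpPiecewise)
      (bloch_classification isExceptionalIdeal_isolatedSet hγ hW hWper hV hVper
        ⟨_, _, hψ.hasSecondDerivOff, heq⟩)
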